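/- Let $p$ be a prime, let $m\le p$ be a nonnegative integer, and let $\lambda=(\lambda_1\ge\lambda_2\ge\cdots)$ be a partition with at most $p$ nonzero parts ($\ell(\lambda)\le p$, $\lambda_i=0$ for $i>\ell(\lambda)$). Let $\mathrm{SST}_m(\lambda)$ be the set of semistandard Young tableaux of shape $\lambda$ with entries in $\{1,\dots,m\}$, let $s_\lambda(x_1,\dots,x_m)=\sum_{T\in \mathrm{SST}_m(\lambda)}\prod_{i} x_i^{\#\{\text{entries } i \text{ of } T\}}$ be the Schur polynomial, $\kappa(\lambda)=\sum_{i\ge1}(i-1)\lambda_i$, and let $\Phi_p(q)$ be the $p$th cyclotomic polynomial. Say that $\lambda\in\mathscr A$ if $\lambda_i-i\equiv\lambda_j-j \pmod p$ for some $1\le i<j\le m$. If a finite cyclic group $C$ acts (not necessarily faithfully) on a finite set $X$ and $f(q)$ is a polynomial with nonnegative integer coefficients, the triple $(X,C,f(q))$ exhibits the cyclic sieving phenomenon if $\#\{x\in X: cx=x\}=f(e^{2\pi i/o(c)})$ for all $c\in C$, where $o(c)$ is the order of $c$. 1. If $\lambda\in\mathscr A$, then $s_\lambda(1,q,\dots,q^{m-1})\equiv0\pmod{\Phi_p(q)}$.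 Conversely, if $\ell(\lambda)\le m$ and $s_\lambda(1,q,\dots,q^{m-1})\equiv 0\pmod{\Phi_p(q)}$, then $\lambda\in\mathscr A$. (So the two are equivalent when $\ell(\lambda)\le m$.) 2. If $\lambda\in\mathscr A$, then there exists an action of a cyclic group $C$ of order $p$ on $\mathrm{SST}_m(\lambda)$ such that $(\mathrm{SST}_m(\lambda),C,q^{-\kappa(\lambda)}s_\lambda(1,q,\dots,q^{m-1}))$ exhibits the cyclic sieving phenomenon. 3. There exists an action of a cyclic group $C$ of order $p$ on $\mathrm{SST}_p(\lambda)$ such that $(\mathrm{SST}_p(\lambda),C,s_\lambda(1,q,\dots,q^{p-1}))$ exhibits the cyclic sieving phenomenon if and only if either the $p$-core of $\lambda$ (the partition obtained by successively removing rim $p$-hooks as long as possible) is not empty, or it is empty and $\operatorname{sign}(w_\lambda)=1$. Here, for $\lambda$ with empty $p$-core, $w_\lambda\in S_p$ is the unique permutation with $\lambda+\delta_p\equiv w_\lambda\,\delta_p\pmod p$ coordinatewise, where $\delta_p=(p-1,p-2,\dots,1,0)$ and $S_p$ acts by permuting coordinates. -/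

import Mathlib

namespace CyclicSieving

open Polynomial

noncomputable section

/-- The number of parts of a partition, partitions being represented by Young diagrams.
The part `λ_i` (`i ≥ 1`) is `lam.rowLen (i - 1)`: rows are counted from `0`. -/
def length (lam : YoungDiagram) : ℕ := lam.colLen 0

/-- `SST_m(λ)`: semistandard Young tableaux of shape `λ` with at most `m` different letters. The
letters `1 < 2 < ⋯ < m` are represented by `0 < 1 < ⋯ < m - 1`. -/
def SST (m : ℕ) (lam : YoungDiagram) : Type :=
  {T : SemistandardYoungTableau lam // ∀ c ∈ lam.cells, T c.1 c.2 < m}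

instance instFiniteSST (m : ℕ) (lam : YoungDiagram) : Finite (SST m lam) := by
  refine Finite.of_injective
    (fun (T : SST m lam) (c : lam.cells) => (⟨T.1 c.1.1 c.1.2, T.2 c.1 c.2⟩ : Fin m)) ?_
  intro T T' h
  apply Subtype.ext
  ext i j
  by_cases hc : (i, j) ∈ lam
  · have := congrFun h ⟨(i, j), hc⟩
    simpa using this
  · rw [T.1.zeros hc, T'.1.zeros hc]

instance instFintypeSST (m : ℕ) (lam : YoungDiagram) : Fintype (SST m lam) := Fintype.ofFinite _

/-- The Schur polynomial `s_λ(x_1, …, x_m)`, the generating function of `SST_m(λ)` by content. -/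
def schur (m : ℕ) (lam : YoungDiagram) : MvPolynomial (Fin m) ℤ :=
  ∑ T : SST m lam, ∏ c : lam.cells, MvPolynomial.X ⟨T.1 c.1.1 c.1.2, T.2 c.1 c.2⟩

/-- The principal specialization `s_λ(1, q, …, q^{m-1})`, a polynomial in `q`. -/
def principalSchur (m : ℕ) (lam : YoungDiagram) : ℤ[X] :=
  MvPolynomial.aeval (fun i : Fin m => (X : ℤ[X]) ^ (i : ℕ)) (schur m lam)

/-- `κ(λ) = ∑_{i ≥ 1} (i - 1) λ_i`. -/
def kappa (lam : YoungDiagram) : ℕ := ∑ i ∈ Finset.range (length lam), i * lam.rowLen i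

/-- `q^{-κ(λ)} s_λ(1, q, …, q^{m-1})`. The division is exact: see
`X_pow_kappa_mul_normalizedSchur`. -/
def normalizedSchur (m : ℕ) (lam : YoungDiagram) : ℤ[X] :=
  principalSchur m lam /ₘ X ^ kappa lam

theorem kappa_eq_sum_cells (lam : YoungDiagram) : kappa lam = ∑ c ∈ lam.cells, c.1 := by
  have hmaps : ∀ c ∈ lam.cells, c.1 ∈ Finset.range (length lam) := by
    intro c hc
    rw [Finset.mem_range, length, ← YoungDiagram.mem_iff_lt_colLen]
    exact lam.up_left_mem le_rfl (Nat.zero_le _) hc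
  rw [kappa, ← Finset.sum_fiberwise_of_maps_to hmaps]
  refine Finset.sum_congr rfl fun i _ => ?_
  have hrow : lam.cells.filter (fun c => c.1 = i) = lam.row i := rfl
  rw [hrow, Finset.sum_congr rfl (fun c hc => (YoungDiagram.mem_row_iff.1 hc).2),
    Finset.sum_const, ← YoungDiagram.rowLen_eq_card, smul_eq_mul, mul_comm]

theorem le_entry {lam : YoungDiagram} (T : SemistandardYoungTableau lam) (i j : ℕ)
    (h : (i, j) ∈ lam) : i ≤ T i j := by
  induction i with
  | zero => exact Nat.zero_le _
  | succ k ih =>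
    have h1 := ih (lam.up_left_mem (Nat.le_succ k) le_rfl h)
    have h2 := T.col_strict (Nat.lt_succ_self k) h
    exact Nat.succ_le_of_lt (lt_of_le_of_lt h1 h2)

theorem X_pow_kappa_mul_normalizedSchur (m : ℕ) (lam : YoungDiagram) :
    X ^ kappa lam * normalizedSchur m lam = principalSchur m lam := by
  have hdvd : (X : ℤ[X]) ^ kappa lam ∣ principalSchur m lam := by
    rw [principalSchur, schur, map_sum]
    refine Finset.dvd_sum fun T _ => ?_
    rw [map_prod, kappa_eq_sum_cells, ← Finset.prod_pow_eq_pow_sum,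
      ← Finset.prod_coe_sort lam.cells]
    refine Finset.prod_dvd_prod_of_dvd _ _ fun c _ => ?_
    rw [MvPolynomial.aeval_X]
    exact pow_dvd_pow _ (le_entry T.1 _ _ c.2)
  have h := modByMonic_add_div (principalSchur m lam) (X ^ kappa lam : ℤ[X])
  rw [(modByMonic_eq_zero_iff_dvd (monic_X_pow _)).2 hdvd, zero_add] at h
  exact h

/-- The triple `(S, C, f)` exhibits the cyclic sieving phenomenon, for an action of the group `C`
on `S`: `f` has nonnegative coefficients and `#S^c = f(exp(2πi / o(c)))` for all `c ∈ C`. -/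
def ExhibitsCSP (S C : Type) [Group C] [MulAction C S] (f : ℤ[X]) : Prop :=
  Finite S ∧ (∀ k, 0 ≤ f.coeff k) ∧
    ∀ c : C, (Nat.card (MulAction.fixedBy S c) : ℂ) =
      aeval (Complex.exp (2 * Real.pi * Complex.I / (orderOf c : ℂ))) f

/-- There is an action of a cyclic group `C` of order `n` on `S` such that `(S, C, f)` exhibits the
cyclic sieving phenomenon. -/
def HasCSPAction (n : ℕ) (S : Type) (f : ℤ[X]) : Prop :=
  ∃ (C : Type) (_ : Group C) (_ : MulAction C S),
    IsCyclic C ∧ Nat.card C = n ∧ ExhibitsCSP S C f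

/-- `λ_i - i ≡ λ_j - j (mod p)` for some `1 ≤ i < j ≤ m` (here with `i` and `j` counted
from `0`, which shifts both sides by the same amount). -/
def ClassA (p m : ℕ) (lam : YoungDiagram) : Prop :=
  ∃ i j : ℕ, i < j ∧ j < m ∧
    (lam.rowLen i : ℤ) - (i : ℤ) ≡ (lam.rowLen j : ℤ) - (j : ℤ) [ZMOD (p : ℤ)]

/-- Two cells share an edge. -/
def CellAdj (c d : ℕ × ℕ) : Prop :=
  (c.1 = d.1 ∧ (c.2 + 1 = d.2 ∨ d.2 + 1 = c.2)) ∨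
    (c.2 = d.2 ∧ (c.1 + 1 = d.1 ∨ d.1 + 1 = c.1))

/-- `μ` arises from `λ` by removing a rim `p`-hook: `λ \ μ` consists of `p` cells, lies on the rim
of `λ`, and is edgewise connected. -/
def RemovesRimHook (p : ℕ) (lam mu : YoungDiagram) : Prop :=
  mu ≤ lam ∧ (lam.cells \ mu.cells).card = p ∧
    (∀ c ∈ lam.cells \ mu.cells, (c.1 + 1, c.2 + 1) ∉ lam) ∧
    ∀ c ∈ lam.cells \ mu.cells, ∀ d ∈ lam.cells \ mu.cells,
      Relation.ReflTransGen (fun a b => CellAdj a b ∧ b ∈ lam.cells \ mu.cells) c d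

/-- `ν` is the `p`-core of `λ`: it arises from `λ` by successively removing rim `p`-hooks, and no
rim `p`-hook can be removed from it. -/
def IsCoreOf (p : ℕ) (lam nu : YoungDiagram) : Prop :=
  Relation.ReflTransGen (RemovesRimHook p) lam nu ∧ ∀ mu, ¬ RemovesRimHook p nu mu

/-- `λ ∼_p μ`: the partitions `λ` and `μ` have the same `p`-core. -/
def SameCore (p : ℕ) (lam mu : YoungDiagram) : Prop :=
  ∃ nu, IsCoreOf p lam nu ∧ IsCoreOf p mu nu

/-- `δ_p = (p - 1, p - 2, …, 1, 0)`. -/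
def delta (p : ℕ) (i : Fin p) : ℕ := p - 1 - (i : ℕ)

/-- `λ + δ_p ≡ w δ_p (mod p)`, where `w` permutes the coordinates: `(w v)_i = v_{w⁻¹ i}`. -/
def IsCorePerm (p : ℕ) (lam : YoungDiagram) (w : Equiv.Perm (Fin p)) : Prop :=
  ∀ i : Fin p, lam.rowLen i + delta p i ≡ delta p (w⁻¹ i) [MOD p]

/-- The permutation `w_λ` is unique. -/
theorem IsCorePerm.unique {p : ℕ} {lam : YoungDiagram} {w w' : Equiv.Perm (Fin p)}
    (h : IsCorePerm p lam w) (h' : IsCorePerm p lam w') : w = w' := by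
  rw [← inv_inj]
  ext i
  have h1 := (h i).symm.trans (h' i)
  have ha := (w⁻¹ i).2
  have hb := (w'⁻¹ i).2
  have h2 := h1.eq_of_lt_of_lt (by unfold delta; omega) (by unfold delta; omega)
  unfold delta at h2
  omega

end

end CyclicSieving

namespace CyclicSieving

open Polynomial

noncomputable section

/-! All three claims come from evaluating the principal specialization at `z = exp(2πi/p)`. By the
bialternant formula (`tableauSum_mul_det`), the Schur polynomial times a Vandermonde determinant is
the alternant with exponents `betaSeq m lam`. In the variables `1, z, z², …` both determinants are
Vandermonde, in the nodes `z ^ i` and `z ^ betaSeq m lam i`. For `m ≤ p` the former is nonzero,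
while the latter vanishes iff two exponents agree mod `p`, which is `ClassA`. For `m = p` with
pairwise distinct exponents mod `p`, its rows permute those of the former, so the value is the sign
of the permutation `w` (`aeval_principalSchur_eq_sign`).

For a group of prime order, cyclic sieving reduces to arithmetic (`hasCSPAction_iff`): since `Φ_p(1)
= p`, an integer value `n` of `f` at `z` satisfies `f(1) ≡ n` mod `p`, so when `0 ≤ n ≤ f(1)` there
is room for `n` fixed points and free orbits. Values `0` and `1` are thus realizable, and `-1` is
not.

It remains to see that the `p`-core is empty iff the `λ_i - i` are distinct mod `p`
(`sameCore_bot_iff`). Removing a rim `p`-hook deletes one cell of each content residue, and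
distinctness says exactly that all residues occur equally often among the contents. -/

/-! ### Recursion for alternants -/

theorem det_pow_succ {R : Type*} [CommRing R] (m : ℕ) (x : ℕ → R) (a : Fin (m + 1) → ℕ)
    (ha : Monotone a) :
    (Matrix.of fun i j : Fin (m + 1) => x j ^ a i).det =
      (-1) ^ m * x m ^ a 0 * (∏ j : Fin m, (x j - x m)) *
        ∑ b ∈ Fintype.piFinset (fun i : Fin m => Finset.Ico (a i.castSucc) (a i.succ)),
          (∏ i, x m ^ (a i.succ - 1 - b i)) * (Matrix.of fun i j : Fin m => x j ^ b i).det := by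
  -- Subtracting from each row the right multiple of its predecessor clears the last column below
  -- its top entry. The other entries then split off `x j - x m`, leaving geometric sums that expand
  -- by multilinearity over interlacing exponents `b`.
  set B : Matrix (Fin (m + 1)) (Fin (m + 1)) R := Matrix.of fun i j =>
    Fin.cases (x j ^ a 0)
      (fun k => x j ^ a k.succ - x j ^ a k.castSucc * x m ^ (a k.succ - a k.castSucc)) i with hB
  have hle : ∀ i : Fin m, a i.castSucc ≤ a i.succ := fun i => ha (Fin.castSucc_lt_succ).le
  have h1 : (Matrix.of fun i j : Fin (m + 1) => x j ^ a i).det = B.det := by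
    refine Matrix.det_eq_of_forall_row_eq_smul_add_pred
      (fun k => x m ^ (a k.succ - a k.castSucc)) ?_ ?_
    · intro j; simp [hB]
    · intro i j; simp [hB]; ring
  have h2 : B.submatrix Fin.succ Fin.castSucc =
      Matrix.of fun i j : Fin m => (x j - x m) * (Matrix.of fun i j : Fin m =>
        ∑ b ∈ Finset.Ico (a i.castSucc) (a i.succ), x m ^ (a i.succ - 1 - b) * x j ^ b) i j := by
    ext i j
    simp only [Matrix.submatrix_apply, Matrix.of_apply, hB, Fin.cases_succ, Fin.val_castSucc]
    rw [← (Commute.all _ _).mul_geom_sum₂_Ico (hle i)]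
    congr 1
    exact Finset.sum_congr rfl fun b _ => mul_comm _ _
  have h3 : (Matrix.of fun i j : Fin m =>
        ∑ b ∈ Finset.Ico (a i.castSucc) (a i.succ), x m ^ (a i.succ - 1 - b) * x j ^ b).det =
      ∑ b ∈ Fintype.piFinset (fun i : Fin m => Finset.Ico (a i.castSucc) (a i.succ)),
        (∏ i, x m ^ (a i.succ - 1 - b i)) * (Matrix.of fun i j : Fin m => x j ^ b i).det := by
    have := (Matrix.detRowAlternating (R := R) (n := Fin m)).toMultilinearMap.map_sum_finset
      (fun i b => fun j : Fin m => x m ^ (a i.succ - 1 - b) * x j ^ b)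
      (fun i : Fin m => Finset.Ico (a i.castSucc) (a i.succ))
    simp only [AlternatingMap.coe_multilinearMap] at this
    convert this using 1
    · change _ = Matrix.det _
      congr 1
      ext i j
      simp
    · refine Finset.sum_congr rfl fun b _ => ?_
      exact (Matrix.det_mul_column (fun i => x m ^ (a i.succ - 1 - b i))
        (Matrix.of fun i j : Fin m => x j ^ b i)).symm
  rw [h1, Matrix.det_succ_column B (Fin.last m), Fin.sum_univ_succ]
  have h4 : ∀ i : Fin m, B i.succ (Fin.last m) = 0 := by
    intro i
    simp [hB, ← pow_add, Nat.add_sub_cancel' (hle i)]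
  simp only [h4, mul_zero, zero_mul, Finset.sum_const_zero, add_zero]
  have h5 : B.submatrix (Fin.succAbove 0) (Fin.succAbove (Fin.last m)) =
      B.submatrix Fin.succ Fin.castSucc := by
    rw [Fin.succAbove_last]; rfl
  rw [h5, h2, Matrix.det_mul_row, h3]
  simp [hB]
  ring

/-! ### Row lengths and the branching rule for tableaux -/

theorem rowLen_eq_zero_of_length_le {lam : YoungDiagram} {k : ℕ} (h : length lam ≤ k) :
    lam.rowLen k = 0 := by
  by_contra h0
  have h1 : (k, 0) ∈ lam := YoungDiagram.mem_iff_lt_rowLen.2 (Nat.pos_of_ne_zero h0)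
  rw [YoungDiagram.mem_iff_lt_colLen] at h1
  exact absurd h1 (not_lt.2 h)

theorem length_le_of_rowLen_eq_zero {lam : YoungDiagram} {k : ℕ} (h : lam.rowLen k = 0) :
    length lam ≤ k := by
  by_contra h0
  have h1 : (k, 0) ∈ lam := YoungDiagram.mem_iff_lt_colLen.2 (not_le.1 h0)
  rw [YoungDiagram.mem_iff_lt_rowLen, h] at h1
  exact absurd h1 (lt_irrefl 0)

theorem rowLen_mono {mu lam : YoungDiagram} (h : mu ≤ lam) (i : ℕ) :
    mu.rowLen i ≤ lam.rowLen i := by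
  by_contra h0
  have h1 : (i, lam.rowLen i) ∈ mu := YoungDiagram.mem_iff_lt_rowLen.2 (not_le.1 h0)
  have h2 : (i, lam.rowLen i) ∈ lam := h h1
  exact lt_irrefl _ (YoungDiagram.mem_iff_lt_rowLen.1 h2)

theorem eq_of_rowLen_eq {mu nu : YoungDiagram} (h : ∀ i, mu.rowLen i = nu.rowLen i) :
    mu = nu := by
  ext ⟨i, j⟩
  rw [YoungDiagram.mem_cells, YoungDiagram.mem_cells, YoungDiagram.mem_iff_lt_rowLen,
    YoungDiagram.mem_iff_lt_rowLen, h]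

theorem sum_cells_eq_sum_range {M : Type*} [AddCommMonoid M] {lam : YoungDiagram} {n : ℕ}
    (h : length lam ≤ n) (f : ℕ × ℕ → M) :
    ∑ c ∈ lam.cells, f c = ∑ i ∈ Finset.range n, ∑ j ∈ Finset.range (lam.rowLen i), f (i, j) := by
  rw [Finset.sum_sigma']
  refine Finset.sum_bij' (fun c _ => ⟨c.1, c.2⟩) (fun c _ => (c.1, c.2)) ?_ ?_ ?_ ?_ ?_
  · rintro ⟨i, j⟩ hc
    have hc' : (i, j) ∈ lam := hc
    simp only [Finset.mem_sigma, Finset.mem_range]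
    refine ⟨lt_of_lt_of_le ?_ h, YoungDiagram.mem_iff_lt_rowLen.1 hc'⟩
    exact YoungDiagram.mem_iff_lt_colLen.1 (lam.up_left_mem le_rfl (Nat.zero_le _) hc')
  · rintro ⟨i, j⟩ hc
    simp only [Finset.mem_sigma, Finset.mem_range] at hc
    exact YoungDiagram.mem_iff_lt_rowLen.2 hc.2
  all_goals simp

theorem card_eq_sum_rowLen {lam : YoungDiagram} {n : ℕ} (h : length lam ≤ n) :
    lam.cells.card = ∑ i : Fin n, lam.rowLen i.rev := by
  rw [Finset.card_eq_sum_ones, sum_cells_eq_sum_range h, Finset.sum_range,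
    ← Equiv.sum_comp Fin.revPerm]
  simp

/-- The subdiagram of the cells of a tableau whose entries are less than `m`. -/
def sublevel {lam : YoungDiagram} (T : SemistandardYoungTableau lam) (m : ℕ) : YoungDiagram where
  cells := lam.cells.filter (fun c => T c.1 c.2 < m)
  isLowerSet := by
    rintro ⟨i, j⟩ ⟨i', j'⟩ ⟨hi, hj⟩ hc
    simp only [Finset.coe_filter, Set.mem_ofPred_eq, YoungDiagram.mem_cells] at hc ⊢
    refine ⟨lam.up_left_mem hi hj hc.1, lt_of_le_of_lt ?_ hc.2⟩
    exact (T.col_weak hi (lam.up_left_mem le_rfl hj hc.1)).trans (T.row_weak_of_le hj hc.1)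

theorem mem_sublevel {lam : YoungDiagram} {T : SemistandardYoungTableau lam} {m i j : ℕ} :
    (i, j) ∈ sublevel T m ↔ (i, j) ∈ lam ∧ T i j < m := by
  rw [← YoungDiagram.mem_cells, sublevel, Finset.mem_filter, YoungDiagram.mem_cells]

theorem sublevel_le {lam : YoungDiagram} (T : SemistandardYoungTableau lam) (m : ℕ) :
    sublevel T m ≤ lam := fun _ h => (mem_sublevel.1 h).1

theorem length_sublevel_le {lam : YoungDiagram} (T : SemistandardYoungTableau lam) (m : ℕ) :
    length (sublevel T m) ≤ m := by
  by_contra h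
  have h1 : (m, 0) ∈ sublevel T m := YoungDiagram.mem_iff_lt_colLen.2 (not_le.1 h)
  rw [mem_sublevel] at h1
  exact absurd (le_entry T m 0 h1.1) (not_le.2 h1.2)

/-- Columns are strict, so a cell directly above another has an entry below `m`: the cells filled
with `m` form a horizontal strip. -/
theorem rowLen_succ_le_sublevel {m : ℕ} {lam : YoungDiagram} (T : SST (m + 1) lam) (i : ℕ) :
    lam.rowLen (i + 1) ≤ (sublevel T.1 m).rowLen i := by
  by_contra h
  have h1 : (i + 1, (sublevel T.1 m).rowLen i) ∈ lam :=
    YoungDiagram.mem_iff_lt_rowLen.2 (not_le.1 h)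
  have h2 := T.1.col_strict (lt_add_one i) h1
  have h3 := T.2 _ h1
  have h4 : (i, (sublevel T.1 m).rowLen i) ∈ sublevel T.1 m :=
    mem_sublevel.2 ⟨lam.up_left_mem (Nat.le_succ i) le_rfl h1, by
      simp only at h3; omega⟩
  exact lt_irrefl _ (YoungDiagram.mem_iff_lt_rowLen.1 h4)

/-- Restriction of a tableau to a subdiagram. -/
def restrictTableau {lam : YoungDiagram} (T : SemistandardYoungTableau lam) (mu : YoungDiagram)
    (h : mu ≤ lam) : SemistandardYoungTableau mu where
  entry i j := if (i, j) ∈ mu then T i j else 0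
  row_weak' := by
    intro i j1 j2 hj hc
    rw [if_pos hc, if_pos (mu.up_left_mem le_rfl hj.le hc)]
    exact T.row_weak hj (h hc)
  col_strict' := by
    intro i1 i2 j hi hc
    rw [if_pos hc, if_pos (mu.up_left_mem hi.le le_rfl hc)]
    exact T.col_strict hi (h hc)
  zeros' := fun hc => if_neg hc

/-- Extension of a tableau by the letter `m` on a horizontal strip. -/
def extendTableau {m : ℕ} {mu : YoungDiagram} (T : SST m mu) (lam : YoungDiagram)
    (hi : ∀ i, lam.rowLen (i + 1) ≤ mu.rowLen i) (h : mu ≤ lam) :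
    SemistandardYoungTableau lam where
  entry i j := if (i, j) ∈ mu then T.1 i j else if (i, j) ∈ lam then m else 0
  row_weak' := by
    intro i j1 j2 hj hc
    by_cases h2 : (i, j2) ∈ mu
    · rw [if_pos h2, if_pos (mu.up_left_mem le_rfl hj.le h2)]
      exact T.1.row_weak hj h2
    · rw [if_neg h2, if_pos hc]
      split_ifs with h1 h3
      · exact (T.2 _ h1).le
      · exact le_rfl
      · exact Nat.zero_le _
  col_strict' := by
    intro i1 i2 j hlt hc
    have h1 : (i1, j) ∈ mu := by
      rw [YoungDiagram.mem_iff_lt_rowLen] at hc ⊢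
      exact lt_of_lt_of_le hc ((lam.rowLen_anti _ _ hlt).trans (hi i1))
    rw [if_pos h1]
    by_cases h2 : (i2, j) ∈ mu
    · rw [if_pos h2]
      exact T.1.col_strict hlt h2
    · rw [if_neg h2, if_pos hc]
      exact T.2 _ h1
  zeros' := by
    intro i j hc
    rw [if_neg (fun hm => hc (h hm)), if_neg hc]

theorem restrictTableau_apply {lam : YoungDiagram} (T : SemistandardYoungTableau lam)
    (mu : YoungDiagram) (h : mu ≤ lam) (i j : ℕ) :
    restrictTableau T mu h i j = if (i, j) ∈ mu then T i j else 0 := rfl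

theorem extendTableau_apply {m : ℕ} {mu : YoungDiagram} (T : SST m mu) (lam : YoungDiagram)
    (hi : ∀ i, lam.rowLen (i + 1) ≤ mu.rowLen i) (h : mu ≤ lam) (i j : ℕ) :
    extendTableau T lam hi h i j =
      if (i, j) ∈ mu then T.1 i j else if (i, j) ∈ lam then m else 0 := rfl

/-- The Schur polynomial of `lam` in `m` variables, evaluated at `x 0, …, x (m - 1)`. -/
def tableauSum {R : Type*} [CommRing R] (m : ℕ) (lam : YoungDiagram) (x : ℕ → R) : R :=
  ∑ T : SST m lam, ∏ c ∈ lam.cells, x (T.1 c.1 c.2)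

-- Branching rule: deleting the letter `m` and refilling the horizontal strip with it are inverse to
-- each other.
open Classical in
theorem sum_filter_sublevel {R : Type*} [CommRing R] (m : ℕ) {mu lam : YoungDiagram} (x : ℕ → R)
    (hi : ∀ i, lam.rowLen (i + 1) ≤ mu.rowLen i) (h : mu ≤ lam) :
    ∑ T : SST (m + 1) lam with sublevel T.1 m = mu, ∏ c ∈ lam.cells, x (T.1 c.1 c.2) =
      x m ^ (lam.cells.card - mu.cells.card) * tableauSum m mu x := by
  have hsub : mu.cells ⊆ lam.cells := h
  rw [tableauSum, Finset.mul_sum]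
  refine Finset.sum_bij'
    (fun T hT => ⟨restrictTableau T.1 mu h, ?_⟩)
    (fun T _ => ⟨extendTableau T lam hi h, ?_⟩) ?_ ?_ ?_ ?_ ?_
  · rintro ⟨i, j⟩ hc
    have hc' : (i, j) ∈ mu := hc
    rw [restrictTableau_apply, if_pos hc']
    rw [← (Finset.mem_filter.1 hT).2] at hc'
    exact (mem_sublevel.1 hc').2
  · rintro ⟨i, j⟩ hc
    have hc' : (i, j) ∈ lam := hc
    rw [extendTableau_apply, if_pos hc']
    split_ifs with h1
    · exact (T.2 _ h1).trans (Nat.lt_succ_self m)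
    · exact Nat.lt_succ_self m
  · intro T hT; exact Finset.mem_univ _
  · intro T _
    refine Finset.mem_filter.2 ⟨Finset.mem_univ _, ?_⟩
    change sublevel (extendTableau T lam hi h) m = mu
    ext ⟨i, j⟩
    rw [YoungDiagram.mem_cells, YoungDiagram.mem_cells, mem_sublevel, extendTableau_apply]
    by_cases h1 : (i, j) ∈ mu
    · rw [if_pos h1]
      exact ⟨fun _ => h1, fun _ => ⟨h h1, T.2 _ h1⟩⟩
    · rw [if_neg h1]
      refine ⟨fun h2 => ?_, fun h2 => absurd h2 h1⟩
      rw [if_pos h2.1] at h2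
      exact absurd h2.2 (lt_irrefl m)
  · intro T hT
    have hT := (Finset.mem_filter.1 hT).2
    apply Subtype.ext
    ext i j
    refine (extendTableau_apply _ lam hi h i j).trans ?_
    change (if (i, j) ∈ mu then restrictTableau T.1 mu h i j else _) = _
    rw [restrictTableau_apply]
    split_ifs with h1 h2
    · rfl
    · rw [← hT, mem_sublevel] at h1
      have h3 := T.2 _ h2
      simp only at h3
      have h4 : ¬ T.1 i j < m := fun h4 => h1 ⟨h2, h4⟩
      omega
    · exact (T.1.zeros h2).symm
  · intro T _
    apply Subtype.ext
    ext i j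
    refine (restrictTableau_apply _ mu h i j).trans ?_
    change (if (i, j) ∈ mu then extendTableau T lam hi h i j else _) = _
    rw [extendTableau_apply]
    split_ifs with h1
    · rfl
    · exact (T.1.zeros h1).symm
  · intro T hT
    have hT := (Finset.mem_filter.1 hT).2
    rw [← Finset.prod_sdiff hsub, ← Finset.card_sdiff_of_subset hsub, ← Finset.prod_const]
    congr 1
    · refine Finset.prod_congr rfl ?_
      rintro ⟨i, j⟩ hc
      rw [Finset.mem_sdiff] at hc
      have h3 := T.2 _ hc.1
      simp only at h3 ⊢
      have h4 : ¬ T.1 i j < m := fun h4 => hc.2 (by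
        rw [← hT]; exact mem_sublevel.2 ⟨hc.1, h4⟩)
      rw [show T.1 i j = m by omega]
    · refine Finset.prod_congr rfl ?_
      rintro ⟨i, j⟩ hc
      change _ = x (restrictTableau T.1 mu h i j)
      rw [restrictTableau_apply, if_pos (show (i, j) ∈ mu from hc)]

theorem exists_subdiagram {lam : YoungDiagram} (f : ℕ → ℕ) (hf : Antitone f)
    (hle : ∀ i, f i ≤ lam.rowLen i) :
    ∃ mu : YoungDiagram, mu ≤ lam ∧ ∀ i, mu.rowLen i = f i := by
  refine ⟨⟨lam.cells.filter (fun c => c.2 < f c.1), ?_⟩, ?_, ?_⟩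
  · rintro ⟨i, j⟩ ⟨i', j'⟩ ⟨hi, hj⟩ hc
    simp only [Finset.coe_filter, Set.mem_ofPred_eq, YoungDiagram.mem_cells] at hc ⊢
    exact ⟨lam.up_left_mem hi hj hc.1, lt_of_le_of_lt hj (lt_of_lt_of_le hc.2 (hf hi))⟩
  · exact Finset.filter_subset _ _
  · intro i
    refine eq_of_forall_lt_iff fun j => ?_
    rw [← YoungDiagram.mem_iff_lt_rowLen]
    refine Finset.mem_filter.trans ?_
    rw [YoungDiagram.mem_cells, YoungDiagram.mem_iff_lt_rowLen]
    exact ⟨fun h => h.2, fun h => ⟨lt_of_lt_of_le h (hle i), h⟩⟩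

/-! ### The bialternant formula -/

/-- The strictly increasing sequence `λ_m < λ_{m-1} + 1 < ⋯ < λ_1 + m - 1`. -/
def betaSeq (m : ℕ) (lam : YoungDiagram) (i : Fin m) : ℕ := lam.rowLen i.rev + i

theorem betaSeq_strictMono (m : ℕ) (lam : YoungDiagram) : StrictMono (betaSeq m lam) := by
  intro i j hij
  have h := lam.rowLen_anti j.rev i.rev (Fin.rev_le_rev.2 hij.le)
  have h2 : (i : ℕ) < j := hij
  unfold betaSeq
  omega

/-- Links the two recursions: the exponent sequences in `det_pow_succ` come from the diagrams in the
branching rule. -/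
theorem exists_interlacing {m : ℕ} {lam : YoungDiagram} {b : Fin m → ℕ}
    (hlam : length lam ≤ m + 1)
    (hb : b ∈ Fintype.piFinset (fun i : Fin m => Finset.Ico (betaSeq (m + 1) lam i.castSucc)
      (betaSeq (m + 1) lam i.succ))) :
    ∃ mu : YoungDiagram, mu ≤ lam ∧ length mu ≤ m ∧ (∀ i, lam.rowLen (i + 1) ≤ mu.rowLen i) ∧
      betaSeq m mu = b := by
  have hb' : ∀ i : Fin m, lam.rowLen (m - i) + i ≤ b i ∧ b i ≤ lam.rowLen (m - 1 - i) + i := by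
    intro i
    have h := Finset.mem_Ico.1 (Fintype.mem_piFinset.1 hb i)
    simp only [betaSeq, Fin.val_rev, Fin.val_castSucc, Fin.val_succ] at h
    rw [show m + 1 - (i + 1) = m - (i : ℕ) by omega,
      show m + 1 - (i + 1 + 1) = m - 1 - (i : ℕ) by omega] at h
    omega
  -- Undoes the reversal and shift in `betaSeq`; rows from `m` on are empty.
  set f : ℕ → ℕ := fun k => if h : k < m then b (Fin.rev ⟨k, h⟩) - (m - 1 - k) else 0 with hf
  have hfk : ∀ k, lam.rowLen (k + 1) ≤ f k ∧ f k ≤ lam.rowLen k := by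
    intro k
    simp only [hf]
    split_ifs with h
    · have := hb' (Fin.rev ⟨k, h⟩)
      simp only [Fin.val_rev] at this
      rw [show m - (m - (k + 1)) = k + 1 by omega,
        show m - 1 - (m - (k + 1)) = k by omega] at this
      omega
    · rw [rowLen_eq_zero_of_length_le (k := k + 1) (by omega)]
      simp
  obtain ⟨mu, h1, h2⟩ := exists_subdiagram (lam := lam) f
    (antitone_nat_of_succ_le fun k => (hfk (k + 1)).2.trans (hfk k).1) (fun i => (hfk i).2)
  refine ⟨mu, h1, ?_, ?_, ?_⟩
  · apply length_le_of_rowLen_eq_zero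
    rw [h2]
    simp [hf]
  · intro i
    rw [h2]
    exact (hfk i).1
  · funext i
    rw [betaSeq, h2]
    simp only [hf, Fin.is_lt, dite_true]
    have := hb' i
    simp only [Fin.eta, Fin.rev_rev]
    simp only [Fin.val_rev]
    omega

theorem sum_betaSeq_sub {m : ℕ} {mu lam : YoungDiagram} (hlam : length lam ≤ m + 1)
    (hmu : length mu ≤ m) (h : mu ≤ lam) :
    lam.cells.card - mu.cells.card = betaSeq (m + 1) lam 0 +
      ∑ i : Fin m, (betaSeq (m + 1) lam i.succ - 1 - betaSeq m mu i) := by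
  have h1 : ∀ i : Fin m, betaSeq (m + 1) lam i.succ - 1 - betaSeq m mu i =
      lam.rowLen i.succ.rev - mu.rowLen i.rev := by
    intro i
    simp only [betaSeq, Fin.val_succ]
    omega
  have h2 : ∀ i : Fin m, mu.rowLen i.rev ≤ lam.rowLen i.succ.rev := by
    intro i
    have := rowLen_mono h i.rev
    rw [Fin.rev_succ, Fin.val_castSucc]
    exact this
  rw [card_eq_sum_rowLen hlam, card_eq_sum_rowLen hmu, Fin.sum_univ_succ,
    Finset.sum_congr rfl fun i _ => h1 i, Finset.sum_tsub_distrib _ fun i _ => h2 i, betaSeq]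
  have := Finset.sum_le_sum fun i (_ : i ∈ Finset.univ) => h2 i
  simp only [Fin.val_zero]
  omega

/-- Induction on `m`: the branching rule and `det_pow_succ` give both sides the same recursion. No
division is needed, so it holds in any commutative ring. -/
theorem tableauSum_mul_det {R : Type*} [CommRing R] (m : ℕ) (lam : YoungDiagram) (x : ℕ → R)
    (hlam : length lam ≤ m) :
    tableauSum m lam x * (Matrix.of fun i j : Fin m => x j ^ (i : ℕ)).det =
      (Matrix.of fun i j : Fin m => x j ^ betaSeq m lam i).det := by
  classical
  induction m generalizing lam with
  | zero =>
    have h0 : lam.cells = ∅ := by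
      rw [← Finset.card_eq_zero, card_eq_sum_rowLen hlam]
      simp
    have : Unique (SST 0 lam) :=
      { default := ⟨SemistandardYoungTableau.highestWeight lam, by simp [h0]⟩
        uniq := by
          intro T
          apply Subtype.ext
          ext i j
          have h : (i, j) ∉ lam := by rw [← YoungDiagram.mem_cells, h0]; simp
          rw [T.1.zeros h, SemistandardYoungTableau.zeros _ h] }
    simp [tableauSum, h0]
  | succ m ih =>
    have key : tableauSum (m + 1) lam x * (Matrix.of fun i j : Fin m => x j ^ (i : ℕ)).det =
        x m ^ betaSeq (m + 1) lam 0 *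
        ∑ b ∈ Fintype.piFinset (fun i : Fin m => Finset.Ico (betaSeq (m + 1) lam i.castSucc)
          (betaSeq (m + 1) lam i.succ)),
          (∏ i, x m ^ (betaSeq (m + 1) lam i.succ - 1 - b i)) *
            (Matrix.of fun i j : Fin m => x j ^ b i).det := by
      have hmaps : ∀ T ∈ (Finset.univ : Finset (SST (m + 1) lam)),
          betaSeq m (sublevel T.1 m) ∈ Fintype.piFinset (fun i : Fin m =>
            Finset.Ico (betaSeq (m + 1) lam i.castSucc) (betaSeq (m + 1) lam i.succ)) := by
        intro T _
        rw [Fintype.mem_piFinset]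
        intro i
        have h1 := rowLen_succ_le_sublevel T i.rev
        have h2 := rowLen_mono (sublevel_le T.1 m) i.rev
        simp only [betaSeq, Finset.mem_Ico, Fin.val_castSucc, Fin.val_succ, Fin.rev_castSucc,
          Fin.rev_succ]
        omega
      rw [tableauSum, ← Finset.sum_fiberwise_of_maps_to hmaps, Finset.sum_mul, Finset.mul_sum]
      refine Finset.sum_congr rfl fun b hb => ?_
      obtain ⟨mu, h1, h2, h3, rfl⟩ := exists_interlacing hlam hb
      have h4 : (Finset.univ.filter fun T : SST (m + 1) lam =>
          betaSeq m (sublevel T.1 m) = betaSeq m mu) =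
          Finset.univ.filter fun T : SST (m + 1) lam => sublevel T.1 m = mu := by
        refine Finset.filter_congr fun T _ => ⟨fun h => ?_, fun h => by rw [h]⟩
        refine eq_of_rowLen_eq fun k => ?_
        by_cases hk : k < m
        · have := congrFun h (Fin.rev ⟨k, hk⟩)
          simpa [betaSeq] using this
        · rw [rowLen_eq_zero_of_length_le ((length_sublevel_le T.1 m).trans (not_lt.1 hk)),
            rowLen_eq_zero_of_length_le (h2.trans (not_lt.1 hk))]
      rw [h4, sum_filter_sublevel m x h3 h1, mul_assoc, ih mu h2, sum_betaSeq_sub hlam h2 h1,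
        pow_add, Finset.prod_pow_eq_pow_sum]
      ring
    have hdelta := det_pow_succ m x (fun i => (i : ℕ)) (fun i j h => h)
    have hpi : Fintype.piFinset (fun i : Fin m =>
        Finset.Ico ((i.castSucc : Fin (m + 1)) : ℕ) (i.succ : Fin (m + 1))) =
        {fun i : Fin m => (i : ℕ)} := by
      ext b
      simp only [Fintype.mem_piFinset, Finset.mem_Ico, Fin.val_castSucc, Fin.val_succ,
        Finset.mem_singleton, funext_iff]
      exact forall_congr' fun i => by omega
    rw [hpi, Finset.sum_singleton] at hdelta
    simp only [Fin.val_zero, Fin.val_succ, Nat.add_sub_cancel, Nat.sub_self, pow_zero, mul_one,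
      Finset.prod_const_one, one_mul] at hdelta
    rw [hdelta, det_pow_succ m x _ (betaSeq_strictMono (m + 1) lam).monotone,
      mul_left_comm, key]
    ring

/-! ### Contents, rim hooks and the empty core -/

/-- The content of a cell. -/
def content (c : ℕ × ℕ) : ℤ := (c.2 : ℤ) - c.1

/-- The number of cells whose content has residue `r`. -/
def residueCount (p : ℕ) (lam : YoungDiagram) (r : ZMod p) : ℕ :=
  (lam.cells.filter fun c => (content c : ZMod p) = r).card

theorem CellAdj.content {c d : ℕ × ℕ} (h : CellAdj c d) :
    content d = content c + 1 ∨ content c = content d + 1 := by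
  unfold CellAdj at h
  unfold CyclicSieving.content
  omega

theorem CellAdj.symm {c d : ℕ × ℕ} (h : CellAdj c d) : CellAdj d c := by
  unfold CellAdj at *
  omega

/-- The rim meets each diagonal at most once. -/
theorem eq_of_content_eq_of_rim {lam : YoungDiagram} {c d : ℕ × ℕ} (hc : c ∈ lam) (hd : d ∈ lam)
    (hc' : (c.1 + 1, c.2 + 1) ∉ lam) (hd' : (d.1 + 1, d.2 + 1) ∉ lam)
    (h : content c = content d) : c = d := by
  unfold content at h
  rcases lt_trichotomy c.1 d.1 with h1 | h1 | h1
  · exact absurd (lam.up_left_mem (by omega) (by omega) hd) hc'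
  · exact Prod.ext h1 (by omega)
  · exact absurd (lam.up_left_mem (by omega) (by omega) hc) hd'

theorem exists_content_eq_of_path {D : Finset (ℕ × ℕ)} {c d : ℕ × ℕ} (hc : c ∈ D)
    (h : Relation.ReflTransGen (fun a b => CellAdj a b ∧ b ∈ D) c d) :
    ∀ k : ℤ, content c ≤ k ∧ k ≤ content d ∨ content d ≤ k ∧ k ≤ content c →
      ∃ e ∈ D, content e = k := by
  induction h with
  | refl => exact fun k hk => ⟨c, hc, by omega⟩
  | @tail b d _ hstep ih =>
    intro k hk
    by_cases hd : content d = k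
    · exact ⟨d, hstep.2, hd⟩
    · refine ih k ?_
      have := hstep.1.content
      omega

/-- Connectedness makes the contents of the hook an interval. Two congruent distinct contents would
force more than `p` cells, so the `p` cells have distinct residues and exhaust `ZMod p`. -/
theorem RemovesRimHook.residueCount {p : ℕ} [NeZero p] {lam mu : YoungDiagram}
    (h : RemovesRimHook p lam mu) (r : ZMod p) :
    residueCount p lam r = residueCount p mu r + 1 := by
  classical
  obtain ⟨hle, hcard, hrim, hconn⟩ := h
  set D := lam.cells \ mu.cells with hD
  have hsub : mu.cells ⊆ lam.cells := hle
  have hmem : ∀ c ∈ D, c ∈ lam := fun c hc => (Finset.mem_sdiff.1 hc).1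
  have hlt : ∀ c ∈ D, ∀ d ∈ D, content c < content d →
      (content c : ZMod p) ≠ (content d : ZMod p) := by
    intro c hc d hd hcd heq
    rw [ZMod.intCast_eq_intCast_iff_dvd_sub] at heq
    have h1 := Int.le_of_dvd (by omega) heq
    have h2 : Finset.Icc (content c) (content d) ⊆ D.image content := by
      intro k hk
      rw [Finset.mem_Icc] at hk
      obtain ⟨e, he, rfl⟩ := exists_content_eq_of_path hc (hconn c hc d hd) k (Or.inl hk)
      exact Finset.mem_image_of_mem _ he
    have h3 := (Finset.card_le_card h2).trans Finset.card_image_le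
    rw [Int.card_Icc, hcard] at h3
    omega
  have hinj : Set.InjOn (fun c => (content c : ZMod p)) D := by
    intro c hc d hd hcd
    rcases lt_trichotomy (content c) (content d) with h1 | h1 | h1
    · exact absurd hcd (hlt c hc d hd h1)
    · exact eq_of_content_eq_of_rim (hmem c hc) (hmem d hd) (hrim c hc) (hrim d hd) h1
    · exact absurd hcd.symm (hlt d hd c hc h1)
  have himg : D.image (fun c => (content c : ZMod p)) = Finset.univ := by
    rw [← Finset.card_eq_iff_eq_univ, Finset.card_image_of_injOn hinj, hcard, ZMod.card]
  have hone : (D.filter fun c => (content c : ZMod p) = r).card = 1 := by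
    obtain ⟨e, he, her⟩ := Finset.mem_image.1 (himg ▸ Finset.mem_univ r)
    refine Finset.card_eq_one.2 ⟨e, ?_⟩
    ext c
    rw [Finset.mem_filter, Finset.mem_singleton]
    constructor
    · rintro ⟨hc, hcr⟩
      exact hinj hc he (hcr.trans her.symm)
    · rintro rfl
      exact ⟨he, her⟩
  unfold CyclicSieving.residueCount
  rw [← hone, ← Finset.union_sdiff_of_subset hsub, Finset.filter_union,
    Finset.card_union_of_disjoint (Finset.disjoint_filter_filter Finset.disjoint_sdiff)]

/-- The residues mod `p` of the numbers `λ_i - i` are pairwise different. -/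
def DistinctResidues (p : ℕ) (lam : YoungDiagram) : Prop :=
  Function.Injective fun i : Fin p => (lam.rowLen i : ZMod p) - (i : ℕ)

/-- Along row `i` the contents run from `-i` up to just before `λ_i - i`, so the counts for `r - 1`
and `r` telescope; the starting points `-i` meet each residue once. -/
theorem card_residue_add_residueCount {p : ℕ} [NeZero p] {lam : YoungDiagram}
    (hlam : length lam ≤ p) (r : ZMod p) :
    (Finset.univ.filter fun i : Fin p => (lam.rowLen i : ZMod p) - (i : ℕ) = r).card +
      residueCount p lam r = 1 + residueCount p lam (r - 1) := by
  classical
  have hcount : ∀ s : ZMod p, (residueCount p lam s : ℤ) = ∑ i : Fin p,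
      ∑ j ∈ Finset.range (lam.rowLen i), if (j : ZMod p) - (i : ℕ) = s then 1 else 0 := by
    intro s
    rw [residueCount, Finset.natCast_card_filter, sum_cells_eq_sum_range hlam, Finset.sum_range]
    simp [content]
  have hrow : ∀ i : Fin p,
      (∑ j ∈ Finset.range (lam.rowLen i), if (j : ZMod p) - (i : ℕ) = r - 1 then (1 : ℤ) else 0) -
      (∑ j ∈ Finset.range (lam.rowLen i), if (j : ZMod p) - (i : ℕ) = r then (1 : ℤ) else 0) =
      (if (lam.rowLen i : ZMod p) - (i : ℕ) = r then 1 else 0) -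
        if -((i : ℕ) : ZMod p) = r then 1 else 0 := by
    intro i
    have := Finset.sum_range_sub
      (fun j : ℕ => if (j : ZMod p) - (i : ℕ) = r then (1 : ℤ) else 0) (lam.rowLen i)
    rw [Finset.sum_sub_distrib] at this
    rw [Nat.cast_zero, zero_sub] at this
    rw [← this]
    congr 1
    refine Finset.sum_congr rfl fun j _ => ?_
    have : ((j : ZMod p) - (i : ℕ) = r - 1) ↔ (((j + 1 : ℕ) : ZMod p) - (i : ℕ) = r) := by
      rw [eq_sub_iff_add_eq]
      push_cast
      rw [sub_add_eq_add_sub]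
    simp only [this]
  have hone : (∑ i : Fin p, if -((i : ℕ) : ZMod p) = r then (1 : ℤ) else 0) = 1 := by
    rw [Finset.sum_eq_single (⟨(-r).val, ZMod.val_lt _⟩ : Fin p)]
    · simp
    · intro i _ hi
      rw [if_neg]
      rintro rfl
      apply hi
      ext
      simp [ZMod.val_cast_of_lt i.2]
    · simp
  have := Finset.sum_congr rfl fun (i : Fin p) (_ : i ∈ Finset.univ) => hrow i
  rw [Finset.sum_sub_distrib, Finset.sum_sub_distrib, ← hcount, ← hcount, hone,
    ← Finset.natCast_card_filter] at this
  omega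

theorem distinctResidues_iff {p : ℕ} [NeZero p] {lam : YoungDiagram} (hlam : length lam ≤ p) :
    DistinctResidues p lam ↔ ∀ r, residueCount p lam r = residueCount p lam (r - 1) := by
  classical
  have hcard := fun r => card_residue_add_residueCount hlam r
  constructor
  · intro h r
    have hbij : Function.Bijective fun i : Fin p => (lam.rowLen i : ZMod p) - (i : ℕ) :=
      (Fintype.bijective_iff_injective_and_card _).2 ⟨h, by simp⟩
    obtain ⟨e, he⟩ := hbij.2 r
    have : (Finset.univ.filter fun i : Fin p => (lam.rowLen i : ZMod p) - (i : ℕ) = r) = {e} := by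
      ext i
      rw [Finset.mem_filter, Finset.mem_singleton]
      exact ⟨fun hi => h (hi.2.trans he.symm), fun hi => ⟨Finset.mem_univ _, hi ▸ he⟩⟩
    have h1 := hcard r
    rw [this, Finset.card_singleton] at h1
    omega
  · intro h i j hij
    have h1 : (Finset.univ.filter fun k : Fin p => (lam.rowLen k : ZMod p) - (k : ℕ) =
        (lam.rowLen j : ZMod p) - (j : ℕ)).card ≤ 1 := by
      have := hcard ((lam.rowLen j : ZMod p) - (j : ℕ))
      have := h ((lam.rowLen j : ZMod p) - (j : ℕ))
      omega
    exact Finset.card_le_one.1 h1 i (by simpa using hij) j (by simp)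

theorem cellAdj_of_rim {lam : YoungDiagram} {c d : ℕ × ℕ} (hc : c ∈ lam) (hd : d ∈ lam)
    (hc' : (c.1 + 1, c.2 + 1) ∉ lam) (hd' : (d.1 + 1, d.2 + 1) ∉ lam)
    (h : content d = content c + 1) : CellAdj c d := by
  have h1 : d.1 ≤ c.1 := by
    by_contra h1
    unfold content at h
    exact hc' (lam.up_left_mem (by omega) (by omega) hd)
  have h2 : c.1 ≤ d.1 + 1 := by
    by_contra h2
    unfold content at h
    exact hd' (lam.up_left_mem (by omega) (by omega) hc)
  unfold content at h
  unfold CellAdj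
  omega

theorem exists_rim_content_eq {lam : YoungDiagram} {c : ℕ × ℕ} (hc : c ∈ lam) :
    ∃ d ∈ lam, (d.1 + 1, d.2 + 1) ∉ lam ∧ content d = content c := by
  by_contra! h
  have hall : ∀ n : ℕ, (c.1 + n, c.2 + n) ∈ lam := by
    intro n
    induction n with
    | zero => exact hc
    | succ n ih =>
      by_contra h1
      refine h _ ih h1 ?_
      unfold content
      push_cast
      ring
  have h2 := YoungDiagram.mem_iff_lt_rowLen.1
    (lam.up_left_mem (Nat.zero_le _) le_rfl (hall (lam.rowLen 0)))
  omega

theorem reflTransGen_of_content {D : Finset (ℕ × ℕ)}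
    (hinj : ∀ c ∈ D, ∀ d ∈ D, content c = content d → c = d)
    (hadj : ∀ c ∈ D, ∀ d ∈ D, content d = content c + 1 → CellAdj c d)
    (hex : ∀ c ∈ D, ∀ d ∈ D, ∀ k, content c ≤ k → k ≤ content d → ∃ e ∈ D, content e = k)
    (n : ℕ) (c d : ℕ × ℕ) (hc : c ∈ D) (hd : d ∈ D) (hn : (content c - content d).natAbs = n) :
    Relation.ReflTransGen (fun a b => CellAdj a b ∧ b ∈ D) c d := by
  induction n generalizing c with
  | zero =>
    rw [hinj c hc d hd (by omega)]
  | succ n ih =>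
    rcases lt_or_ge (content c) (content d) with h | h
    · obtain ⟨e, he, hec⟩ := hex c hc d hd (content c + 1) (by omega) (by omega)
      exact (ih e he (by omega)).head ⟨hadj c hc e he hec, he⟩
    · obtain ⟨e, he, hec⟩ := hex d hd c hc (content c - 1) (by omega) (by omega)
      exact (ih e he (by omega)).head ⟨(hadj e he c hc (by omega)).symm, he⟩

theorem DistinctResidues.not_wrap {p : ℕ} {lam : YoungDiagram} (h : DistinctResidues p lam)
    {k : ℕ} (hk0 : 0 < k) (hkp : k < p) : lam.rowLen k + p ≠ lam.rowLen 0 + k := by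
  intro heq
  have h1 := congrArg (Nat.cast : ℕ → ZMod p) heq
  push_cast at h1
  rw [ZMod.natCast_self, add_zero] at h1
  have h2 := @h ⟨k, hkp⟩ ⟨0, hk0.trans hkp⟩ (by simp [h1])
  have h3 := congrArg Fin.val h2
  simp only at h3
  omega

/-- The hook starts at the end of the first row: it consists of the rim cells of content at least
`λ_1 - p`. What remains could fail to be a diagram, or the hook be too short, only if some lower row
ended at the diagonal excluded by `not_wrap`. -/
theorem DistinctResidues.exists_removesRimHook {p : ℕ} {lam : YoungDiagram}
    (h : DistinctResidues p lam) (hlam : length lam ≤ p) (hne : lam ≠ ⊥) :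
    ∃ mu, RemovesRimHook p lam mu := by
  classical
  have hpos : 0 < lam.rowLen 0 := by
    rw [Nat.pos_iff_ne_zero]
    intro h0
    apply hne
    refine eq_of_rowLen_eq fun i => ?_
    have h1 := lam.rowLen_anti 0 i (Nat.zero_le _)
    have h2 : (⊥ : YoungDiagram).rowLen i = 0 := by
      by_contra h2
      exact YoungDiagram.notMem_bot (i, 0)
        (YoungDiagram.mem_iff_lt_rowLen.2 (Nat.pos_of_ne_zero h2))
    omega
  have hrow : ∀ {i j}, (i, j) ∈ lam → i < p := fun hij => lt_of_lt_of_le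
    (YoungDiagram.mem_iff_lt_colLen.1 (lam.up_left_mem le_rfl (Nat.zero_le _) hij)) hlam
  let mu : YoungDiagram :=
    { cells := lam.cells.filter
        fun c => (c.1 + 1, c.2 + 1) ∈ lam ∨ c.2 + p < lam.rowLen 0 + c.1
      isLowerSet := by
        rintro ⟨x', y'⟩ ⟨x, y⟩ ⟨hx, hy⟩ ha
        simp only [Finset.coe_filter, Set.mem_ofPred_eq, YoungDiagram.mem_cells] at ha hx hy ⊢
        refine ⟨lam.up_left_mem hx hy ha.1, ?_⟩
        by_contra hb
        push Not at hb
        rcases ha.2 with h1 | h1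
        · exact hb.1 (lam.up_left_mem (by omega) (by omega) h1)
        rcases hy.eq_or_lt with rfl | hy
        -- In column `y`, this row holds the cell of content `lam.rowLen 0 - p - 1`, which is the
        -- last cell of its row.
        · refine h.not_wrap (k := y + p - lam.rowLen 0 + 1) (by omega) ?_ ?_
          · have := hrow ha.1
            omega
          · have h2 : (y + p - lam.rowLen 0 + 1, y) ∈ lam :=
              lam.up_left_mem (by omega) le_rfl ha.1
            have h3 : (y + p - lam.rowLen 0 + 1, y + 1) ∉ lam := fun h3 =>
              hb.1 (lam.up_left_mem (by omega) le_rfl h3)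
            rw [YoungDiagram.mem_iff_lt_rowLen] at h2 h3
            have := hb.2
            omega
        · have hxx : x' = x := by
            by_contra hxx
            exact hb.1 (lam.up_left_mem (by omega) (by omega) ha.1)
          omega }
  have hD : ∀ c, c ∈ lam.cells \ mu.cells ↔
      c ∈ lam ∧ (c.1 + 1, c.2 + 1) ∉ lam ∧ (lam.rowLen 0 : ℤ) - p ≤ content c := by
    intro c
    rw [Finset.mem_sdiff, Finset.mem_filter, YoungDiagram.mem_cells]
    unfold content
    by_cases h1 : (c.1 + 1, c.2 + 1) ∈ lam <;> by_cases h2 : c ∈ lam <;> simp [h1, h2]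
    omega
  have hupper : ∀ c ∈ lam, content c ≤ lam.rowLen 0 - 1 := by
    intro c hc
    have h1 := YoungDiagram.mem_iff_lt_rowLen.1 (lam.up_left_mem (Nat.zero_le c.1) le_rfl hc)
    unfold content
    omega
  have hex : ∀ k : ℤ, (lam.rowLen 0 : ℤ) - p ≤ k → k ≤ lam.rowLen 0 - 1 →
      ∃ e ∈ lam.cells \ mu.cells, content e = k := by
    intro k hk1 hk2
    suffices hcell : ∃ c ∈ lam, content c = k by
      obtain ⟨c, hc, hck⟩ := hcell
      obtain ⟨d, hd, hd', hdc⟩ := exists_rim_content_eq hc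
      exact ⟨d, (hD d).2 ⟨hd, hd', by omega⟩, by omega⟩
    rcases le_or_gt 0 k with hk | hk
    · exact ⟨(0, k.toNat), YoungDiagram.mem_iff_lt_rowLen.2 (by omega), by
        unfold content; simp; omega⟩
    · refine ⟨((-k).toNat, 0), ?_, by unfold content; simp; omega⟩
      by_contra h1
      -- If the first column stops too early, this row is empty and so ends at content `lam.rowLen 0
      -- - p`.
      refine h.not_wrap (k := p - lam.rowLen 0) (by omega) (by omega) ?_
      have h2 : (p - lam.rowLen 0, 0) ∉ lam := fun h2 =>
        h1 (lam.up_left_mem (by omega) le_rfl h2)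
      rw [YoungDiagram.mem_iff_lt_rowLen] at h2
      omega
  have hinj : ∀ c ∈ lam.cells \ mu.cells, ∀ d ∈ lam.cells \ mu.cells,
      content c = content d → c = d := fun c hc d hd =>
    eq_of_content_eq_of_rim ((hD c).1 hc).1 ((hD d).1 hd).1 ((hD c).1 hc).2.1 ((hD d).1 hd).2.1
  refine ⟨mu, Finset.filter_subset _ _, ?_, fun c hc => ((hD c).1 hc).2.1, fun c hc d hd => ?_⟩
  · have himg : (lam.cells \ mu.cells).image content =
        Finset.Icc ((lam.rowLen 0 : ℤ) - p) (lam.rowLen 0 - 1) := by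
      ext k
      rw [Finset.mem_image, Finset.mem_Icc]
      constructor
      · rintro ⟨c, hc, rfl⟩
        exact ⟨((hD c).1 hc).2.2, hupper c ((hD c).1 hc).1⟩
      · exact fun hk => hex k hk.1 hk.2
    rw [← Finset.card_image_of_injOn (fun c hc d hd => hinj c hc d hd), himg, Int.card_Icc]
    omega
  · refine reflTransGen_of_content hinj (fun c hc d hd => ?_) (fun c hc d hd k h1 h2 => ?_)
      _ c d hc hd rfl
    · exact cellAdj_of_rim ((hD c).1 hc).1 ((hD d).1 hd).1 ((hD c).1 hc).2.1 ((hD d).1 hd).2.1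
    · exact hex k (((hD c).1 hc).2.2.trans h1) (h2.trans (hupper d ((hD d).1 hd).1))

theorem not_removesRimHook_bot {p : ℕ} [NeZero p] (mu : YoungDiagram) :
    ¬ RemovesRimHook p ⊥ mu := by
  intro h
  have := h.2.1
  simp only [YoungDiagram.cells_bot, Finset.empty_sdiff, Finset.card_empty] at this
  exact NeZero.ne p this.symm

theorem length_mono {mu lam : YoungDiagram} (h : mu ≤ lam) : length mu ≤ length lam := by
  apply length_le_of_rowLen_eq_zero
  have := rowLen_mono h (length lam)
  rw [rowLen_eq_zero_of_length_le le_rfl] at this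
  omega

/-- Equality of all residue counts is unchanged by hook removal and holds for `⊥`; conversely it
lets hooks be removed until nothing is left. -/
theorem sameCore_bot_iff {p : ℕ} [NeZero p] {lam : YoungDiagram} (hlam : length lam ≤ p) :
    SameCore p lam ⊥ ↔ DistinctResidues p lam := by
  constructor
  · rintro ⟨nu, h1, h2⟩
    have hnu : nu = ⊥ := by
      rcases h2.1.cases_head with h | ⟨mu, h, _⟩
      · exact h.symm
      · exact absurd h (not_removesRimHook_bot mu)
    subst hnu
    rw [distinctResidues_iff hlam]
    refine Relation.ReflTransGen.head_induction_on
      (motive := fun mu _ => ∀ r, residueCount p mu r = residueCount p mu (r - 1)) h1.1 ?_ ?_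
    · simp [residueCount]
    · intro a c hac _ ih r
      rw [hac.residueCount, hac.residueCount, ih]
  · intro h
    refine ⟨⊥, ⟨?_, not_removesRimHook_bot⟩, Relation.ReflTransGen.refl, not_removesRimHook_bot⟩
    induction hn : lam.cells.card using Nat.strong_induction_on generalizing lam with
    | _ n ih =>
      by_cases hne : lam = ⊥
      · rw [hne]
      · obtain ⟨mu, hmu⟩ := h.exists_removesRimHook hlam hne
        have hmulen := (length_mono hmu.1).trans hlam
        refine (ih mu.cells.card ?_ hmulen ?_ rfl).head hmu
        · have h1 : mu.cells ⊆ lam.cells := hmu.1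
          have h2 := Finset.card_sdiff_add_card_eq_card h1
          rw [hmu.2.1, hn] at h2
          have := NeZero.pos p
          omega
        · rw [distinctResidues_iff hmulen]
          intro r
          have := (distinctResidues_iff hlam).1 h r
          rw [hmu.residueCount, hmu.residueCount] at this
          omega

theorem distinctResidues_iff_not_classA {p : ℕ} {lam : YoungDiagram} :
    DistinctResidues p lam ↔ ¬ ClassA p p lam := by
  have hmod : ∀ i j : ℕ, ((lam.rowLen i : ℤ) - (i : ℤ) ≡ (lam.rowLen j : ℤ) - (j : ℤ)
      [ZMOD (p : ℤ)]) ↔ (lam.rowLen i : ZMod p) - i = (lam.rowLen j : ZMod p) - j := by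
    intro i j
    rw [← ZMod.intCast_eq_intCast_iff]
    push_cast
    rfl
  constructor
  · rintro h ⟨i, j, hij, hj, hc⟩
    rw [hmod] at hc
    have := congrArg Fin.val (@h ⟨i, hij.trans hj⟩ ⟨j, hj⟩ hc)
    simp only at this
    omega
  · intro h i j hij
    rcases lt_trichotomy i j with h1 | h1 | h1
    · exact absurd ⟨i, j, h1, j.2, (hmod i j).2 hij⟩ h
    · exact h1
    · exact absurd ⟨j, i, h1, i.2, (hmod j i).2 hij.symm⟩ h

/-! ### Cyclic sieving for groups of prime order -/

/-- A permutation action of a cyclic group of order `p` with `n` fixed points and `k` free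
orbits. -/
abbrev orbitAction {S : Type} {n k p : ℕ} (e : S ≃ Fin n ⊕ (Fin k × ZMod p)) :
    MulAction (Multiplicative (ZMod p)) S where
  smul c s := e.symm (Sum.map id (fun x => (x.1, Multiplicative.toAdd c + x.2)) (e s))
  one_smul s := by
    change e.symm (Sum.map id (fun x => (x.1, 0 + x.2)) (e s)) = s
    rw [Equiv.symm_apply_eq]
    rcases e s with x | x <;> simp
  mul_smul c d s := by
    change e.symm (Sum.map id (fun x => (x.1, (Multiplicative.toAdd c + Multiplicative.toAdd d) +
      x.2)) (e s)) = e.symm (Sum.map id (fun x => (x.1, Multiplicative.toAdd c + x.2))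
        (e (e.symm (Sum.map id (fun x => (x.1, Multiplicative.toAdd d + x.2)) (e s)))))
    rw [Equiv.apply_symm_apply]
    rcases e s with x | x <;> simp [add_assoc]

theorem natCard_fixedBy_orbitAction {S : Type} {n k p : ℕ} (e : S ≃ Fin n ⊕ (Fin k × ZMod p))
    {c : Multiplicative (ZMod p)} (hc : c ≠ 1) :
    Nat.card (@MulAction.fixedBy _ S _ (orbitAction e) c) = n := by
  have hrange : @MulAction.fixedBy _ S _ (orbitAction e) c =
      Set.range fun i : Fin n => e.symm (Sum.inl i) := by
    ext s
    change e.symm (Sum.map id (fun x => (x.1, Multiplicative.toAdd c + x.2)) (e s)) = s ↔ _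
    rw [Equiv.symm_apply_eq, Set.mem_range]
    simp only [Equiv.symm_apply_eq]
    rcases e s with x | x
    · simp
    · have hc' : Multiplicative.toAdd c ≠ 0 := hc
      simp [Prod.ext_iff, hc']
  rw [hrange, Nat.card_range_of_injective, Nat.card_fin]
  exact fun i j h => Sum.inl_injective (e.symm.injective h)

theorem norm_aeval_le {f : ℤ[X]} (hf : ∀ k, 0 ≤ f.coeff k) {z : ℂ} (hz : ‖z‖ = 1) :
    ‖aeval z f‖ ≤ (f.eval 1 : ℤ) := by
  rw [aeval_eq_sum_range, eval_eq_sum_range]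
  refine (norm_sum_le _ _).trans ?_
  push_cast
  refine Finset.sum_le_sum fun k _ => ?_
  have h : (0 : ℝ) ≤ f.coeff k := by exact_mod_cast hf k
  rw [zsmul_eq_mul, norm_mul, norm_pow, hz, Complex.norm_intCast, abs_of_nonneg h]

theorem cyclotomic_dvd_iff {p : ℕ} (hp : 0 < p) {z : ℂ} (hz : IsPrimitiveRoot z p) (f : ℤ[X]) :
    cyclotomic p ℤ ∣ f ↔ aeval z f = 0 := by
  rw [cyclotomic_eq_minpoly hz hp, minpoly.isIntegrallyClosed_dvd_iff (hz.isIntegral hp)]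

/-- All nontrivial elements have order `p`, so only the value at one root of unity matters. The
triangle inequality gives `n ≤ |S|`, and evaluating `Φ_p ∣ f - n` at `1` gives `p ∣ |S| - n`. -/
theorem hasCSPAction_iff {p : ℕ} (hp : p.Prime) {S : Type} [Finite S] {f : ℤ[X]}
    (hf : ∀ k, 0 ≤ f.coeff k) (hf1 : f.eval 1 = Nat.card S) :
    HasCSPAction p S f ↔ ∃ n : ℕ, aeval (Complex.exp (2 * Real.pi * Complex.I / p)) f = n := by
  have := Fact.mk hp
  have hz : IsPrimitiveRoot (Complex.exp (2 * Real.pi * Complex.I / p)) p :=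
    Complex.isPrimitiveRoot_exp p hp.ne_zero
  have horder : ∀ {C : Type} [Group C] (_ : Nat.card C = p) (c : C), c ≠ 1 → orderOf c = p :=
    fun hC c hc => ((Nat.dvd_prime hp).1 (hC ▸ orderOf_dvd_natCard c)).resolve_left
      fun h => hc (orderOf_eq_one_iff.1 h)
  constructor
  · rintro ⟨C, _, _, _, hC, _, _, h⟩
    have : Finite C := Nat.finite_of_card_ne_zero (hC ▸ hp.ne_zero)
    have : Nontrivial C := Finite.one_lt_card_iff_nontrivial.1 (hC ▸ hp.one_lt)
    obtain ⟨c, hc⟩ := exists_ne (1 : C)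
    refine ⟨Nat.card (MulAction.fixedBy S c), ?_⟩
    rw [h c, horder hC c hc]
  · rintro ⟨n, hn⟩
    have hle : n ≤ Nat.card S := by
      have h := norm_aeval_le hf (hz.norm'_eq_one hp.ne_zero)
      rw [hn, hf1, Complex.norm_natCast] at h
      exact_mod_cast h
    have hdvd : p ∣ Nat.card S - n := by
      have h : cyclotomic p ℤ ∣ f - C (n : ℤ) := by
        rw [cyclotomic_dvd_iff hp.pos hz, map_sub, hn]
        simp
      obtain ⟨g, hg⟩ := h
      have h1 := congrArg (eval 1) hg
      rw [eval_sub, eval_mul, eval_one_cyclotomic_prime, hf1, eval_C] at h1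
      have h2 : (p : ℤ) ∣ ((Nat.card S - n : ℕ) : ℤ) := by
        rw [Nat.cast_sub hle]
        exact ⟨_, h1⟩
      exact_mod_cast h2
    obtain ⟨k, hk⟩ := hdvd
    have hcard : Nat.card S = Nat.card (Fin n ⊕ (Fin k × ZMod p)) := by
      rw [Nat.card_sum, Nat.card_prod, Nat.card_fin, Nat.card_fin, Nat.card_zmod, mul_comm]
      omega
    let e : S ≃ Fin n ⊕ (Fin k × ZMod p) := (Finite.card_eq.1 hcard).some
    have hC : Nat.card (Multiplicative (ZMod p)) = p := by simp
    refine ⟨Multiplicative (ZMod p), inferInstance, orbitAction e, inferInstance, hC,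
      inferInstance, hf, fun c => ?_⟩
    by_cases hc : c = 1
    · subst hc
      let := orbitAction e
      rw [MulAction.fixedBy_one_eq_univ, Nat.card_univ, orderOf_one, Nat.cast_one, div_one,
        Complex.exp_two_pi_mul_I]
      have h1 : aeval (1 : ℂ) f = ((f.eval 1 : ℤ) : ℂ) := by
        rw [aeval_def, eval₂_eq_sum_range, eval_eq_sum_range]
        simp
      rw [h1, hf1]
      simp
    · rw [natCard_fixedBy_orbitAction e hc, horder hC c hc, hn]

/-! ### The principal specialization at a root of unity -/

theorem principalSchur_eq (m : ℕ) (lam : YoungDiagram) :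
    principalSchur m lam = ∑ T : SST m lam, X ^ ∑ c ∈ lam.cells, T.1 c.1 c.2 := by
  rw [principalSchur, schur, map_sum]
  refine Finset.sum_congr rfl fun T _ => ?_
  rw [map_prod, ← Finset.prod_pow_eq_pow_sum, ← Finset.prod_coe_sort lam.cells]
  refine Finset.prod_congr rfl fun c _ => ?_
  rw [MvPolynomial.aeval_X]

theorem aeval_principalSchur (m : ℕ) (lam : YoungDiagram) (z : ℂ) :
    aeval z (principalSchur m lam) = tableauSum m lam fun i => z ^ i := by
  rw [principalSchur_eq, map_sum, tableauSum]
  refine Finset.sum_congr rfl fun T _ => ?_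
  rw [map_pow, aeval_X, Finset.prod_pow_eq_pow_sum]

theorem coeff_principalSchur_nonneg (m : ℕ) (lam : YoungDiagram) (k : ℕ) :
    0 ≤ (principalSchur m lam).coeff k := by
  rw [principalSchur_eq, finsetSum_coeff]
  refine Finset.sum_nonneg fun T _ => ?_
  rw [coeff_X_pow]
  split_ifs <;> norm_num

theorem eval_one_principalSchur (m : ℕ) (lam : YoungDiagram) :
    (principalSchur m lam).eval 1 = Nat.card (SST m lam) := by
  rw [principalSchur_eq, eval_finsetSum]
  simp

theorem coeff_normalizedSchur_nonneg (m : ℕ) (lam : YoungDiagram) (k : ℕ) :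
    0 ≤ (normalizedSchur m lam).coeff k := by
  rw [← coeff_X_pow_mul _ (kappa lam), X_pow_kappa_mul_normalizedSchur]
  exact coeff_principalSchur_nonneg m lam _

theorem eval_one_normalizedSchur (m : ℕ) (lam : YoungDiagram) :
    (normalizedSchur m lam).eval 1 = Nat.card (SST m lam) := by
  rw [← eval_one_principalSchur, ← X_pow_kappa_mul_normalizedSchur]
  simp

theorem det_pow_pow_eq_vandermonde {m : ℕ} (z : ℂ) (a : Fin m → ℕ) :
    (Matrix.of fun i j : Fin m => (z ^ (j : ℕ)) ^ a i).det =
      (Matrix.vandermonde fun i => z ^ a i).det := by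
  congr 1
  ext i j
  rw [Matrix.of_apply, Matrix.vandermonde_apply, ← pow_mul, ← pow_mul, mul_comm]

theorem det_vandermonde_pow_ne_zero {m p : ℕ} (hm : m ≤ p) {z : ℂ} (hz : IsPrimitiveRoot z p) :
    (Matrix.vandermonde fun i : Fin m => z ^ (i : ℕ)).det ≠ 0 := by
  rw [Matrix.det_vandermonde_ne_zero_iff]
  intro i j hij
  exact Fin.ext (hz.pow_inj (lt_of_lt_of_le i.2 hm) (lt_of_lt_of_le j.2 hm) hij)

theorem classA_iff {p m : ℕ} {lam : YoungDiagram} :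
    ClassA p m lam ↔ ∃ i j : Fin m, betaSeq m lam i ≡ betaSeq m lam j [MOD p] ∧ i ≠ j := by
  have hmod : ∀ i j : Fin m, (betaSeq m lam i ≡ betaSeq m lam j [MOD p]) ↔
      (lam.rowLen i.rev : ℤ) - (i.rev : ℕ) ≡ (lam.rowLen j.rev : ℤ) - (j.rev : ℕ)
        [ZMOD (p : ℤ)] := by
    intro i j
    have h : ∀ k : Fin m, (betaSeq m lam k : ℤ) =
        ((lam.rowLen k.rev : ℤ) - (k.rev : ℕ)) + (m - 1) := by
      intro k
      have := k.2
      simp only [betaSeq, Fin.val_rev]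
      omega
    rw [← Int.natCast_modEq_iff, h, h]
    exact ⟨fun h => Int.ModEq.add_right_cancel' _ h, fun h => h.add_right _⟩
  constructor
  · rintro ⟨i, j, hij, hj, h⟩
    refine ⟨Fin.rev ⟨i, hij.trans hj⟩, Fin.rev ⟨j, hj⟩, ?_, ?_⟩
    · rw [hmod, Fin.rev_rev, Fin.rev_rev]
      exact h
    · intro he
      have := congrArg Fin.val (Fin.rev_injective he)
      simp only at this
      omega
  · rintro ⟨i, j, h, hne⟩
    rw [hmod] at h
    rcases lt_or_gt_of_ne (Fin.rev_injective.ne hne) with hlt | hlt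
    · exact ⟨_, _, hlt, j.rev.2, h⟩
    · exact ⟨_, _, hlt, i.rev.2, h.symm⟩

theorem pow_eq_pow_iff_modEq_of_isPrimitiveRoot {p : ℕ} (hp : p ≠ 0) {z : ℂ}
    (hz : IsPrimitiveRoot z p) {a b : ℕ} : z ^ a = z ^ b ↔ a ≡ b [MOD p] := by
  rw [(hz.isOfFinOrder hp).pow_inj_mod, ← hz.eq_orderOf, Nat.ModEq]

theorem aeval_principalSchur_eq_zero_iff {p m : ℕ} (hp : 0 < p) (hm : m ≤ p) {z : ℂ}
    (hz : IsPrimitiveRoot z p) {lam : YoungDiagram} (hlam : length lam ≤ m) :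
    aeval z (principalSchur m lam) = 0 ↔ ClassA p m lam := by
  have h := tableauSum_mul_det m lam (fun i => z ^ i) hlam
  rw [det_pow_pow_eq_vandermonde, det_pow_pow_eq_vandermonde, ← aeval_principalSchur] at h
  rw [← mul_eq_zero_iff_right (det_vandermonde_pow_ne_zero hm hz), h, Matrix.det_vandermonde_eq_zero_iff,
    classA_iff]
  simp only [pow_eq_pow_iff_modEq_of_isPrimitiveRoot hp.ne' hz]

theorem aeval_principalSchur_eq_zero {p m : ℕ} (hp : 0 < p) (hm : m ≤ p) {z : ℂ}
    (hz : IsPrimitiveRoot z p) {lam : YoungDiagram} (h : ClassA p m lam) :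
    aeval z (principalSchur m lam) = 0 := by
  by_cases hlam : length lam ≤ m
  · exact (aeval_principalSchur_eq_zero_iff hp hm hz hlam).2 h
  -- A first column longer than `m` cannot be strictly filled with `m` letters, so the sum is empty.
  · have : IsEmpty (SST m lam) := ⟨fun T => by
      have h1 : (m, 0) ∈ lam := YoungDiagram.mem_iff_lt_colLen.2 (not_le.1 hlam)
      exact absurd (T.2 _ h1) (not_lt.2 (le_entry T.1 m 0 h1))⟩
    rw [aeval_principalSchur, tableauSum, Finset.univ_eq_empty, Finset.sum_empty]

theorem delta_eq_rev {p : ℕ} (i : Fin p) : delta p i = i.rev := by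
  rw [delta, Fin.val_rev]
  omega

theorem DistinctResidues.exists_isCorePerm {p : ℕ} {lam : YoungDiagram}
    (h : DistinctResidues p lam) : ∃ w, IsCorePerm p lam w := by
  have hpos : ∀ i : Fin p, 0 < p := fun i => i.pos
  let g : Fin p → Fin p := fun i =>
    Fin.rev ⟨(lam.rowLen i + delta p i) % p, Nat.mod_lt _ (hpos i)⟩
  have hg : Function.Injective g := by
    intro i j hij
    have h1 : (lam.rowLen i + delta p i) % p = (lam.rowLen j + delta p j) % p :=
      congrArg Fin.val (Fin.rev_injective hij)
    have h2 : ((lam.rowLen i + delta p i : ℕ) : ZMod p) = (lam.rowLen j + delta p j : ℕ) :=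
      (ZMod.natCast_eq_natCast_iff _ _ _).2 h1
    have h3 : ∀ k : Fin p, ((lam.rowLen k + delta p k : ℕ) : ZMod p) =
        (lam.rowLen k : ZMod p) - (k : ℕ) + ((p - 1 : ℕ) : ZMod p) := by
      intro k
      rw [delta, Nat.cast_add, Nat.cast_sub (by have := k.2; omega)]
      ring
    rw [h3, h3] at h2
    exact h (add_right_cancel h2)
  refine ⟨(Equiv.ofBijective g (Finite.injective_iff_bijective.1 hg))⁻¹, fun i => ?_⟩
  rw [inv_inv, delta_eq_rev (Equiv.ofBijective g _ i), Equiv.ofBijective_apply, Fin.rev_rev]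
  exact (Nat.mod_modEq _ _).symm

theorem aeval_principalSchur_eq_sign {p : ℕ} {z : ℂ} (hz : IsPrimitiveRoot z p)
    {lam : YoungDiagram} (hlam : length lam ≤ p) {w : Equiv.Perm (Fin p)}
    (hw : IsCorePerm p lam w) :
    aeval z (principalSchur p lam) = ((Equiv.Perm.sign w : ℤ) : ℂ) := by
  have h := tableauSum_mul_det p lam (fun i => z ^ i) hlam
  rw [det_pow_pow_eq_vandermonde, det_pow_pow_eq_vandermonde, ← aeval_principalSchur] at h
  -- `betaSeq` lists rows from the bottom while `delta` lists them from the top; conjugating by the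
  -- reversal reconciles them and preserves the sign.
  set σ : Equiv.Perm (Fin p) := Fin.revPerm * w⁻¹ * Fin.revPerm with hσ
  have hsign : Equiv.Perm.sign σ = Equiv.Perm.sign w := by
    rw [hσ, map_mul, map_mul, mul_right_comm, Int.units_mul_self, one_mul, Equiv.Perm.sign_inv]
  have hrow : (Matrix.vandermonde fun i => z ^ betaSeq p lam i) =
      (Matrix.vandermonde fun i : Fin p => z ^ (i : ℕ)).submatrix σ id := by
    ext i j
    have h1 : betaSeq p lam i ≡ (σ i : ℕ) [MOD p] := by
      have h2 := hw i.rev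
      rw [delta_eq_rev, delta_eq_rev, Fin.rev_rev] at h2
      exact h2
    rw [← pow_eq_pow_iff_modEq_of_isPrimitiveRoot i.pos.ne' hz] at h1
    rw [Matrix.vandermonde_apply, Matrix.submatrix_apply, Matrix.vandermonde_apply, h1, id]
  rw [hrow, Matrix.det_permute, hsign] at h
  exact mul_right_cancel₀ (det_vandermonde_pow_ne_zero le_rfl hz) h

end

end CyclicSieving


theorem proposition4p6 (p m : ℕ) (hp : p.Prime) (hm : m ≤ p) (lam : YoungDiagram)
    (hlam : CyclicSieving.length lam ≤ p) :
    -- (1): the condition implies the congruence; the converse is for partitions of length `≤ m`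
    ((CyclicSieving.ClassA p m lam →
        Polynomial.cyclotomic p ℤ ∣ CyclicSieving.principalSchur m lam) ∧
      (CyclicSieving.length lam ≤ m →
        Polynomial.cyclotomic p ℤ ∣ CyclicSieving.principalSchur m lam →
        CyclicSieving.ClassA p m lam)) ∧
    -- (2)
    (CyclicSieving.ClassA p m lam →
      CyclicSieving.HasCSPAction p (CyclicSieving.SST m lam)
        (CyclicSieving.normalizedSchur m lam)) ∧
    -- (3)
    (CyclicSieving.HasCSPAction p (CyclicSieving.SST p lam)
        (CyclicSieving.principalSchur p lam) ↔
      (¬ CyclicSieving.SameCore p lam ⊥ ∨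
        (CyclicSieving.SameCore p lam ⊥ ∧
          ∃ w : Equiv.Perm (Fin p), CyclicSieving.IsCorePerm p lam w ∧
            Equiv.Perm.sign w = 1))) := by
  have : NeZero p := ⟨hp.ne_zero⟩
  have hz := Complex.isPrimitiveRoot_exp p hp.ne_zero
  refine ⟨⟨fun h => ?_, fun hl h => ?_⟩, fun h => ?_, ?_⟩
  · rw [CyclicSieving.cyclotomic_dvd_iff hp.pos hz]
    exact CyclicSieving.aeval_principalSchur_eq_zero hp.pos hm hz h
  · rw [CyclicSieving.cyclotomic_dvd_iff hp.pos hz] at h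
    exact (CyclicSieving.aeval_principalSchur_eq_zero_iff hp.pos hm hz hl).1 h
  · rw [CyclicSieving.hasCSPAction_iff hp (CyclicSieving.coeff_normalizedSchur_nonneg m lam)
      (CyclicSieving.eval_one_normalizedSchur m lam)]
    refine ⟨0, ?_⟩
    have h1 := CyclicSieving.aeval_principalSchur_eq_zero hp.pos hm hz h
    rw [← CyclicSieving.X_pow_kappa_mul_normalizedSchur, map_mul, map_pow, Polynomial.aeval_X,
      mul_eq_zero] at h1
    -- Dividing by a power of `q` cannot affect vanishing at a root of unity.
    rw [h1.resolve_left (pow_ne_zero _ (hz.ne_zero hp.ne_zero)), Nat.cast_zero]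
  · rw [CyclicSieving.hasCSPAction_iff hp (CyclicSieving.coeff_principalSchur_nonneg p lam)
      (CyclicSieving.eval_one_principalSchur p lam), CyclicSieving.sameCore_bot_iff hlam]
    by_cases hD : CyclicSieving.DistinctResidues p lam
    · obtain ⟨w, hw⟩ := hD.exists_isCorePerm
      rw [CyclicSieving.aeval_principalSchur_eq_sign hz hlam hw]
      constructor
      · rintro ⟨n, hn⟩
        refine Or.inr ⟨hD, w, hw, (Int.units_eq_one_or _).resolve_right fun h => ?_⟩
        have h1 : ((Equiv.Perm.sign w : ℤˣ) : ℤ) = n := by exact_mod_cast hn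
        rw [h] at h1
        simp only [Units.val_neg, Units.val_one] at h1
        omega
      · rintro (h | ⟨_, w', hw', h⟩)
        · exact absurd hD h
        · rw [hw.unique hw', h]
          exact ⟨1, by simp⟩
    · have hA := not_not.1 (mt CyclicSieving.distinctResidues_iff_not_classA.2 hD)
      exact ⟨fun _ => Or.inl hD, fun _ =>
        ⟨0, by rw [CyclicSieving.aeval_principalSchur_eq_zero hp.pos le_rfl hz hA, Nat.cast_zero]⟩⟩
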